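/- The zero-pattern of a matrix $X=[X_{i,j}]$ over a field is the $(0,1)$-matrix $\underline{X}$ of the same size with $\underline{X}_{i,j}=1$ if $X_{i,j}\neq 0$ and $\underline{X}_{i,j}=0$ if $X_{i,j}=0$. Let $U(n)$ denote the set of complex $n\times n$ matrices $X$ with $XX^{\dagger}=I$, let $O(n)$ denote the set of real $n\times n$ matrices $Y$ with $YY^{T}=I$, and let $O_n(\mathbb{Q})$ denote the set of those matrices in $O(n)$ all of whose entries are rational. **Theorem.** Let $n\le 5$. Then: 1. for every $X\in U(n)$ there exists $Y\in O(n)$ such that $\underline{X}=\underline{Y}$; 2. for every $Y\in O(n)$ there exists $Z\in O_n(\mathbb{Q})$ such that $\underline{Y}=\underline{Z}$. -/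

import Mathlib

/-- The zero-pattern (support) of a matrix `X` over a field: the `(0,1)`-matrix whose entry at
`(i, j)` is `1` if `X i j ≠ 0` and `0` if `X i j = 0`. -/
noncomputable def zeroPattern {m n K : Type*} [Field K] (X : Matrix m n K) : Matrix m n ℕ :=
  open Classical in Matrix.of fun i j => if X i j ≠ 0 then 1 else 0

/-- The set of rational orthogonal matrices of size `n`: the real orthogonal matrices all of whose
entries are rational. -/
def rationalOrthogonal (n : ℕ) : Set (Matrix (Fin n) (Fin n) ℝ) :=
  {X | X ∈ Matrix.orthogonalGroup (Fin n) ℝ ∧ ∀ i j, ∃ q : ℚ, (q : ℝ) = X i j}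

/-!
Call a Boolean matrix a unitary pattern over `K` if it records the nonzero entries of a unitary
matrix over `K`. We show that over a field with a positive definite involution every unitary
pattern of size at most five is one over `ℚ`.

If a row or a column has at most two nonzero entries, a rotation of two columns, or of two rows,
splits off a `1 × 1` block. It can be undone with the rational rotation by `3 / 5`, `4 / 5`, or
trivially, so induction on the size applies. Otherwise all rows and columns have at least three
nonzero entries, hence any two rows meet. Counting pairwise orthogonal vectors in `K ^ T` for a set
`T` of columns then restricts the pattern so strongly that the remaining ones can be enumerated up
to permutations of rows and columns, a rearrangement with largest `∑ 2 ^ (i + j)` over its nonzero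
positions having increasing rows and columns. Each surviving pattern belongs to an integer matrix
that is a multiple of an orthogonal one.
-/

open Finset Matrix

/-- The Boolean matrix `P` is the pattern of nonzero entries of some unitary matrix over `R`. Over
a ring with trivial involution, such as `ℚ`, this says that it is the pattern of an orthogonal
matrix. -/
def IsUnitaryPattern (R : Type*) [CommRing R] [StarRing R] {ι : Type*} [Fintype ι] [DecidableEq ι]
    (P : Matrix ι ι Bool) : Prop :=
  ∃ X ∈ unitaryGroup ι R, ∀ i j, P i j = true ↔ X i j ≠ 0

namespace IsUnitaryPattern

section Symmetry

variable {R : Type*} [CommRing R] [StarRing R] {ι κ : Type*} [Fintype ι] [DecidableEq ι]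
  [Fintype κ] [DecidableEq κ] {P : Matrix ι ι Bool}

theorem submatrix (hP : IsUnitaryPattern R P) (σ τ : κ ≃ ι) :
    IsUnitaryPattern R (P.submatrix σ τ) := by
  obtain ⟨X, hX, hXP⟩ := hP
  refine ⟨X.submatrix σ τ, ?_, fun i j => hXP _ _⟩
  rw [mem_unitaryGroup_iff, star_eq_conjTranspose] at hX ⊢
  rw [conjTranspose_submatrix, submatrix_mul_equiv, hX, submatrix_one_equiv]

theorem of_submatrix {σ τ : κ ≃ ι} (hP : IsUnitaryPattern R (P.submatrix σ τ)) :
    IsUnitaryPattern R P := by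
  simpa using hP.submatrix σ.symm τ.symm

theorem transpose (hP : IsUnitaryPattern R P) : IsUnitaryPattern R Pᵀ := by
  obtain ⟨X, hX, hXP⟩ := hP
  refine ⟨Xᵀ, ?_, fun i j => hXP _ _⟩
  rw [mem_unitaryGroup_iff', star_eq_conjTranspose] at hX
  rw [mem_unitaryGroup_iff, star_eq_conjTranspose]
  have h := congrArg Matrix.transpose hX
  rwa [transpose_mul, transpose_one] at h

theorem of_transpose (hP : IsUnitaryPattern R Pᵀ) : IsUnitaryPattern R P :=
  hP.transpose

end Symmetry

end IsUnitaryPattern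

/-! ### Patterns with a sparse row -/

section SplitColumn

variable {R : Type*} [CommRing R] [StarRing R] {m : ℕ}

/-- Prepend to `Z` the row `(1, 0, …, 0)` and a zero column below it, then multiply on the right by
the rotation `!![a, b; -star b, star a]` of the first two columns. -/
def splitColumn (a b : R) (Z : Matrix (Fin (m + 1)) (Fin (m + 1)) R) :
    Matrix (Fin (m + 2)) (Fin (m + 2)) R :=
  of (vecCons (vecCons a (vecCons b 0)) fun i =>
    vecCons (-(Z i 0 * star b)) (vecCons (Z i 0 * star a) fun j => Z i j.succ))

theorem splitColumn_mem_unitaryGroup_iff {a b : R} (hab : a * star a + b * star b = 1)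
    {Z : Matrix (Fin (m + 1)) (Fin (m + 1)) R} :
    splitColumn a b Z ∈ unitaryGroup _ R ↔ Z ∈ unitaryGroup _ R := by
  have hsucc (i k : Fin (m + 1)) :
      (splitColumn a b Z * star (splitColumn a b Z)) i.succ k.succ = (Z * star Z) i k := by
    simp only [splitColumn, Matrix.mul_apply, of_apply, cons_val', cons_val_succ, star_apply,
      Fin.sum_univ_succ, cons_val_zero, star_neg, star_mul', star_star, mul_neg, neg_mul, neg_neg]
    linear_combination Z i 0 * star (Z k 0) * hab
  have hone (i k : Fin (m + 1)) : (1 : Matrix (Fin (m + 2)) (Fin (m + 2)) R) i.succ k.succ =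
      (1 : Matrix (Fin (m + 1)) (Fin (m + 1)) R) i k := by
    simp [Matrix.one_apply]
  rw [mem_unitaryGroup_iff, mem_unitaryGroup_iff]
  refine ⟨fun h => ?_, fun h => ?_⟩
  · ext i k
    rw [← hsucc, h, hone]
  · ext i k
    cases i using Fin.cases with
    | zero =>
      cases k using Fin.cases with
      | zero => simpa [splitColumn, Matrix.mul_apply, Fin.sum_univ_succ] using hab
      | succ k =>
        simp only [splitColumn, Matrix.mul_apply, of_apply, cons_val', cons_val_zero, star_apply,
          cons_val_succ, Fin.sum_univ_succ, star_neg, star_mul', star_star, mul_neg, Pi.zero_apply,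
          zero_mul, sum_const_zero, add_zero, one_apply_ne (Fin.succ_ne_zero _).symm]
        ring
    | succ i =>
      cases k using Fin.cases with
      | zero =>
        simp only [splitColumn, Matrix.mul_apply, of_apply, cons_val', cons_val_zero, star_apply,
          cons_val_succ, Fin.sum_univ_succ, neg_mul, Pi.zero_apply, star_zero, mul_zero,
          sum_const_zero, add_zero, one_apply_ne (Fin.succ_ne_zero _)]
        ring
      | succ k => rw [hsucc, h, hone]

theorem exists_eq_splitColumn {X : Matrix (Fin (m + 2)) (Fin (m + 2)) R}
    (hX : X ∈ unitaryGroup _ R) (h0 : ∀ j : Fin m, X 0 j.succ.succ = 0) :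
    ∃ Z ∈ unitaryGroup (Fin (m + 1)) R, X 0 0 * star (X 0 0) + X 0 1 * star (X 0 1) = 1 ∧
      X = splitColumn (X 0 0) (X 0 1) Z := by
  have hdot (i : Fin (m + 2)) : X i 0 * star (X 0 0) + X i 1 * star (X 0 1) =
      (1 : Matrix (Fin (m + 2)) (Fin (m + 2)) R) i 0 := by
    simpa [Matrix.mul_apply, Fin.sum_univ_succ, h0] using
      congrFun (congrFun (mem_unitaryGroup_iff.mp hX) i) 0
  have hnorm : X 0 0 * star (X 0 0) + X 0 1 * star (X 0 1) = 1 := by simpa using hdot 0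
  have horth (i : Fin (m + 1)) : X i.succ 0 * star (X 0 0) + X i.succ 1 * star (X 0 1) = 0 := by
    simpa using hdot i.succ
  let Z : Matrix (Fin (m + 1)) (Fin (m + 1)) R := of fun i =>
    vecCons (X i.succ 1 * X 0 0 - X i.succ 0 * X 0 1) fun j => X i.succ j.succ.succ
  have hXZ : X = splitColumn (X 0 0) (X 0 1) Z := by
    ext i j
    refine i.cases ?_ (fun i => ?_) <;> refine j.cases ?_ fun j => j.cases ?_ fun j => ?_
    · rfl
    · rfl
    · exact h0 j
    · change X i.succ 0 = -((X i.succ 1 * X 0 0 - X i.succ 0 * X 0 1) * star (X 0 1))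
      linear_combination X 0 0 * horth i - X i.succ 0 * hnorm
    · change X i.succ 1 = (X i.succ 1 * X 0 0 - X i.succ 0 * X 0 1) * star (X 0 0)
      linear_combination X 0 1 * horth i - X i.succ 1 * hnorm
    · rfl
  exact ⟨Z, (splitColumn_mem_unitaryGroup_iff hnorm).mp (hXZ ▸ hX), hnorm, hXZ⟩

theorem splitColumn_ne_zero_iff [IsDomain R] {S : Type*} [CommRing S] [StarRing S] [IsDomain S]
    {a b : R} {Z : Matrix (Fin (m + 1)) (Fin (m + 1)) R} {a' b' : S}
    {Z' : Matrix (Fin (m + 1)) (Fin (m + 1)) S} (ha : a ≠ 0 ↔ a' ≠ 0) (hb : b ≠ 0 ↔ b' ≠ 0)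
    (hZ : ∀ i j, Z i j ≠ 0 ↔ Z' i j ≠ 0) (i j : Fin (m + 2)) :
    splitColumn a b Z i j ≠ 0 ↔ splitColumn a' b' Z' i j ≠ 0 := by
  simp only [ne_eq, not_iff_not] at ha hb hZ
  refine i.cases ?_ (fun i => ?_) <;> refine j.cases ?_ fun j => j.cases ?_ fun j => ?_ <;>
    simp [splitColumn, ha, hb, hZ]

end SplitColumn

theorem exists_rat_sq_add_sq_eq_one {p q : Prop} (h : p ∨ q) :
    ∃ a b : ℚ, a * star a + b * star b = 1 ∧ (p ↔ a ≠ 0) ∧ (q ↔ b ≠ 0) := by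
  by_cases hp : p
  · by_cases hq : q
    · exact ⟨3 / 5, 4 / 5, by norm_num, by simp [hp], by simp [hq]⟩
    · exact ⟨1, 0, by norm_num, by simp [hp], by simp [hq]⟩
  · exact ⟨0, 1, by norm_num, by simp [hp], by simp [h.resolve_left hp]⟩

namespace IsUnitaryPattern

section Reduction

variable {K : Type*} [Field K] [StarRing K]

theorem rat_of_subsingleton {ι : Type*} [Fintype ι] [DecidableEq ι] [Subsingleton ι]
    {P : Matrix ι ι Bool} (hP : IsUnitaryPattern K P) : IsUnitaryPattern ℚ P := by
  obtain ⟨X, hX, hXP⟩ := hP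
  refine ⟨1, one_mem _, fun i j => ?_⟩
  obtain rfl := Subsingleton.elim i j
  have hnorm : X i i * star (X i i) = 1 := by
    simpa [Matrix.mul_apply, Fintype.sum_subsingleton _ i] using
      congrFun (congrFun (mem_unitaryGroup_iff.mp hX) i) i
  simpa [hXP] using left_ne_zero_of_mul_eq_one hnorm

theorem rat_of_first_row {m : ℕ} {P : Matrix (Fin (m + 2)) (Fin (m + 2)) Bool}
    (ih : ∀ Q : Matrix (Fin (m + 1)) (Fin (m + 1)) Bool,
      IsUnitaryPattern K Q → IsUnitaryPattern ℚ Q)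
    (hP : IsUnitaryPattern K P) (h0 : ∀ j : Fin m, P 0 j.succ.succ = false) :
    IsUnitaryPattern ℚ P := by
  classical
  obtain ⟨X, hX, hXP⟩ := hP
  obtain ⟨Z, hZ, hnorm, hXZ⟩ := exists_eq_splitColumn hX fun j => by
    simpa [h0 j] using hXP 0 j.succ.succ
  obtain ⟨Y, hY, hYZ⟩ := ih (of fun i j => decide (Z i j ≠ 0)) ⟨Z, hZ, fun i j => by simp⟩
  obtain ⟨a, b, hab, ha, hb⟩ : ∃ a b : ℚ, a * star a + b * star b = 1 ∧
      (X 0 0 ≠ 0 ↔ a ≠ 0) ∧ (X 0 1 ≠ 0 ↔ b ≠ 0) := by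
    refine exists_rat_sq_add_sq_eq_one ?_
    by_contra! hzero
    simp [hzero] at hnorm
  refine ⟨splitColumn a b Y, (splitColumn_mem_unitaryGroup_iff hab).mpr hY, fun i j => ?_⟩
  rw [hXP, hXZ]
  exact splitColumn_ne_zero_iff ha hb (fun i j => by simpa using hYZ i j) i j

end Reduction

end IsUnitaryPattern

section RowSupport

variable {ι κ : Type*} [Fintype κ]

/-- The set of columns in which row `i` of the pattern `P` is nonzero. -/
def rowSupport (P : Matrix ι κ Bool) (i : ι) : Finset κ :=
  {j | P i j}

@[simp]
theorem mem_rowSupport {P : Matrix ι κ Bool} {i : ι} {j : κ} :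
    j ∈ rowSupport P i ↔ P i j = true := by
  simp [rowSupport]

theorem card_rowSupport_submatrix (P : Matrix ι κ Bool)
    (σ : Equiv.Perm ι) (τ : Equiv.Perm κ) (i : ι) :
    #(rowSupport (P.submatrix σ τ) i) = #(rowSupport P (σ i)) :=
  card_equiv τ fun j => by simp

end RowSupport

theorem exists_perm_zero_one {m : ℕ} {p q : Fin (m + 2)} (h : p ≠ q) :
    ∃ τ : Equiv.Perm (Fin (m + 2)), τ 0 = p ∧ τ 1 = q := by
  have hne : Equiv.swap 0 p q ≠ 0 := by
    rw [ne_eq, Equiv.swap_apply_eq_iff, Equiv.swap_apply_left]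
    exact h.symm
  refine ⟨Equiv.swap 0 p * Equiv.swap 1 (Equiv.swap 0 p q), ?_, by simp⟩
  rw [Equiv.Perm.mul_apply, Equiv.swap_apply_of_ne_of_ne zero_ne_one hne.symm,
    Equiv.swap_apply_left]

namespace IsUnitaryPattern

theorem rat_of_card_rowSupport_le_two {K : Type*} [Field K] [StarRing K] {m : ℕ}
    {P : Matrix (Fin (m + 2)) (Fin (m + 2)) Bool}
    (ih : ∀ Q : Matrix (Fin (m + 1)) (Fin (m + 1)) Bool,
      IsUnitaryPattern K Q → IsUnitaryPattern ℚ Q)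
    (hP : IsUnitaryPattern K P) {i : Fin (m + 2)} (hi : #(rowSupport P i) ≤ 2) :
    IsUnitaryPattern ℚ P := by
  obtain ⟨u, hu, -, hcard⟩ :=
    exists_subsuperset_card_eq (subset_univ (rowSupport P i)) hi (by simp)
  obtain ⟨p, q, hpq, rfl⟩ := card_eq_two.mp hcard
  obtain ⟨τ, rfl, rfl⟩ := exists_perm_zero_one hpq
  refine of_submatrix (σ := Equiv.swap 0 i) (τ := τ)
    (rat_of_first_row ih (hP.submatrix _ _) fun j => ?_)
  by_contra h
  have hj : τ j.succ.succ ∈ rowSupport P i := by simpa using h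
  simpa [Fin.ext_iff] using hu hj

end IsUnitaryPattern

/-! ### Obstructions from orthogonality -/

theorem pairwise_orthogonal_optionElim {R ι κ : Type*} [CommRing R] [StarRing R] [Fintype ι]
    {v : κ → ι → R} (horth : Pairwise fun a b => v a ⬝ᵥ star (v b) = 0) {x : ι → R}
    (hx : ∀ a, x ⬝ᵥ star (v a) = 0) :
    Pairwise fun a b : Option κ => a.elim x v ⬝ᵥ star (b.elim x v) = 0 := by
  rintro (_ | a) (_ | b) hab
  · exact absurd rfl hab
  · exact hx b
  · change v a ⬝ᵥ star x = 0
    rw [dotProduct_star, hx, star_zero]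
  · exact horth fun h => hab (congrArg some h)

section Orthogonality

variable {K : Type*} [Field K] [PartialOrder K] [StarRing K] [StarOrderedRing K]
  {ι κ : Type*} [Fintype ι] [Fintype κ] {v : κ → ι → K}

theorem card_le_of_pairwise_orthogonal (hv : ∀ a, v a ≠ 0)
    (horth : Pairwise fun a b => v a ⬝ᵥ star (v b) = 0) : Fintype.card κ ≤ Fintype.card ι := by
  classical
  have hdiag : of v * (of v)ᴴ = diagonal fun a => v a ⬝ᵥ star (v a) := by
    ext a b
    obtain rfl | hab := eq_or_ne a b
    · rw [diagonal_apply_eq]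
      rfl
    · rw [diagonal_apply_ne _ hab]
      exact horth hab
  calc Fintype.card κ = (diagonal fun a => v a ⬝ᵥ star (v a)).rank := by
        simp [rank_diagonal, hv]
    _ = (of v * (of v)ᴴ).rank := by rw [hdiag]
    _ ≤ (of v).rank := rank_mul_le_left _ _
    _ ≤ Fintype.card ι := rank_le_card_width _

theorem exists_smul_eq_of_orthogonal (hv : ∀ a, v a ≠ 0)
    (horth : Pairwise fun a b => v a ⬝ᵥ star (v b) = 0)
    (hcard : Fintype.card ι ≤ Fintype.card κ + 1) {x y : ι → K} (hx0 : x ≠ 0)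
    (hx : ∀ a, x ⬝ᵥ star (v a) = 0) (hy : ∀ a, y ⬝ᵥ star (v a) = 0) : ∃ c : K, y = c • x := by
  have hxx : x ⬝ᵥ star x ≠ 0 := mt dotProduct_self_star_eq_zero.mp hx0
  refine ⟨(y ⬝ᵥ star x) / (x ⬝ᵥ star x), ?_⟩
  by_contra hne
  let z : ι → K := y - ((y ⬝ᵥ star x) / (x ⬝ᵥ star x)) • x
  have hzx : z ⬝ᵥ star x = 0 := by
    rw [sub_dotProduct, smul_dotProduct, smul_eq_mul, div_mul_cancel₀ _ hxx, sub_self]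
  have hz (a : κ) : z ⬝ᵥ star (v a) = 0 := by
    rw [sub_dotProduct, smul_dotProduct, hx, hy, smul_zero, sub_zero]
  have hcard' := card_le_of_pairwise_orthogonal (κ := Option (Option κ))
    (Option.forall.mpr ⟨sub_ne_zero.mpr hne, Option.forall.mpr ⟨hx0, hv⟩⟩)
    (pairwise_orthogonal_optionElim (pairwise_orthogonal_optionElim horth hx)
      (Option.forall.mpr ⟨hzx, hz⟩))
  rw [Fintype.card_option, Fintype.card_option] at hcard'
  lia

end Orthogonality

theorem restrict_row_dotProduct_eq_zero {R ι : Type*} [CommRing R] [StarRing R] [Fintype ι]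
    [DecidableEq ι] {X : Matrix ι ι R} (hX : X ∈ unitaryGroup ι R) {i k : ι} (hik : i ≠ k)
    {T : Finset ι} (hT : ∀ j, X i j ≠ 0 → X k j ≠ 0 → j ∈ T) :
    (fun j : T => X i j) ⬝ᵥ star (fun j : T => X k j) = 0 := by
  have hsupp : ∀ j ∈ univ, j ∉ T → X i j * star (X k j) = 0 := fun j _ hj => by
    by_contra hne
    exact hj (hT j (left_ne_zero_of_mul hne) (star_ne_zero.mp (right_ne_zero_of_mul hne)))
  calc (fun j : T => X i j) ⬝ᵥ star (fun j : T => X k j) = ∑ j ∈ T, X i j * star (X k j) :=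
        sum_coe_sort T fun j => X i j * star (X k j)
    _ = ∑ j, X i j * star (X k j) := sum_subset (subset_univ T) hsupp
    _ = (1 : Matrix ι ι R) i k := congrFun (congrFun (mem_unitaryGroup_iff.mp hX) i) k
    _ = 0 := one_apply_ne hik

namespace IsUnitaryPattern

theorem rowSupport_nonempty {R ι : Type*} [CommRing R] [StarRing R] [Nontrivial R] [Fintype ι]
    [DecidableEq ι] {P : Matrix ι ι Bool} (hP : IsUnitaryPattern R P) (i : ι) :
    (rowSupport P i).Nonempty := by
  obtain ⟨X, hX, hXP⟩ := hP
  have hnorm : ∑ j, X i j * star (X i j) ≠ 0 := by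
    have h : (X * star X) i i = 1 := by rw [mem_unitaryGroup_iff.mp hX, one_apply_eq]
    exact h.trans_ne one_ne_zero
  obtain ⟨j, -, hj⟩ := exists_ne_zero_of_sum_ne_zero hnorm
  exact ⟨j, mem_rowSupport.mpr ((hXP i j).mpr (left_ne_zero_of_mul hj))⟩

section Obstructions

variable {K : Type*} [Field K] [PartialOrder K] [StarRing K] [StarOrderedRing K]
  {ι : Type*} [Fintype ι] [DecidableEq ι] {P : Matrix ι ι Bool} {A S T : Finset ι}
  {i i' i'' s t : ι}

theorem card_le (hP : IsUnitaryPattern K P) (hmeet : ∀ i ∈ S, (rowSupport P i ∩ T).Nonempty)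
    (hover : (S : Set ι).Pairwise fun i k => rowSupport P i ∩ rowSupport P k ⊆ T) : #S ≤ #T := by
  obtain ⟨X, hX, hXP⟩ := hP
  let v (i : S) (j : T) : K := X i j
  have hv (i : S) : v i ≠ 0 := by
    obtain ⟨j, hj⟩ := hmeet i i.2
    rw [mem_inter, mem_rowSupport, hXP] at hj
    exact fun h => hj.1 (congrFun h ⟨j, hj.2⟩)
  have horth : Pairwise fun i k => v i ⬝ᵥ star (v k) = 0 := fun i k hik =>
    restrict_row_dotProduct_eq_zero hX (Subtype.coe_ne_coe.mpr hik) fun j hij hkj =>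
      hover i.2 k.2 (Subtype.coe_ne_coe.mpr hik) <| mem_inter.mpr
        ⟨mem_rowSupport.mpr ((hXP _ _).mpr hij), mem_rowSupport.mpr ((hXP _ _).mpr hkj)⟩
  simpa using card_le_of_pairwise_orthogonal hv horth

-- The rows in `A` span a hyperplane of `K ^ T`, so any two rows orthogonal to them are
-- proportional on `T`.
theorem rowSupport_inter_subset (hP : IsUnitaryPattern K P) (hA : ∀ i ∈ A, rowSupport P i ⊆ T)
    (hcard : #T ≤ #A + 1) (hs : s ∉ A) (ht : t ∉ A) (hsT : (rowSupport P s ∩ T).Nonempty) :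
    rowSupport P t ∩ T ⊆ rowSupport P s := by
  have hne := hP.rowSupport_nonempty
  obtain ⟨X, hX, hXP⟩ := hP
  have hmem {i j : ι} : j ∈ rowSupport P i ↔ X i j ≠ 0 := mem_rowSupport.trans (hXP i j)
  have horth {k : ι} {a : A} (hka : k ≠ a) :
      (fun j : T => X k j) ⬝ᵥ star (fun j : T => X a j) = 0 :=
    restrict_row_dotProduct_eq_zero hX hka fun j _ haj => hA a a.2 (hmem.mpr haj)
  have hv (a : A) : (fun j : T => X a j) ≠ 0 := by
    obtain ⟨j, hj⟩ := hne a
    exact fun h => hmem.mp hj (congrFun h ⟨j, hA a a.2 hj⟩)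
  have hsX : (fun j : T => X s j) ≠ 0 := by
    obtain ⟨j, hj⟩ := hsT
    rw [mem_inter, hmem] at hj
    exact fun h => hj.1 (congrFun h ⟨j, hj.2⟩)
  obtain ⟨c, hc⟩ : ∃ c : K, (fun j : T => X t j) = c • fun j : T => X s j :=
    exists_smul_eq_of_orthogonal hv (fun a b hab => horth (Subtype.coe_ne_coe.mpr hab))
      (by simpa using hcard) hsX (fun a => horth (ne_of_mem_of_not_mem a.2 hs).symm)
      fun a => horth (ne_of_mem_of_not_mem a.2 ht).symm
  intro j hj
  rw [mem_inter, hmem] at hj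
  rw [hmem]
  have hj' : X t j = c * X s j := congrFun hc ⟨j, hj.2⟩
  exact right_ne_zero_of_mul (hj' ▸ hj.1)

theorem card_rowSupport_inter_ne_one (hP : IsUnitaryPattern K P) (h : i ≠ i') :
    #(rowSupport P i ∩ rowSupport P i') ≠ 1 := by
  intro hone
  have hne : (rowSupport P i ∩ rowSupport P i').Nonempty := card_pos.mp (by lia)
  have hle : #{i, i'} ≤ #(rowSupport P i ∩ rowSupport P i') := by
    refine hP.card_le ?_ ?_
    · simpa [← inter_assoc, inter_comm (rowSupport P i'), inter_right_idem] using hne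
    · simp [Set.pairwise_pair, inter_comm]
  rw [card_pair h] at hle
  lia

theorem rowSupport_subset_of_rowSupport_eq (hP : IsUnitaryPattern K P) (h : i ≠ i')
    (heq : rowSupport P i = rowSupport P i') (hthree : #(rowSupport P i) = 3)
    (hcol : ∀ j, 3 ≤ #(rowSupport Pᵀ j)) (hs : (rowSupport P s ∩ rowSupport P i).Nonempty) :
    rowSupport P i ⊆ rowSupport P s := by
  by_cases hsA : s ∈ ({i, i'} : Finset ι)
  · obtain rfl | rfl : s = i ∨ s = i' := by simpa using hsA
    · exact Subset.rfl
    · exact heq.le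
  intro j hj
  obtain ⟨t, htj, htA⟩ : ∃ t ∈ rowSupport Pᵀ j, t ∉ ({i, i'} : Finset ι) :=
    exists_mem_notMem_of_card_lt_card (card_le_two.trans_lt (hcol j))
  refine hP.rowSupport_inter_subset (A := {i, i'}) (T := rowSupport P i) ?_ ?_ hsA htA hs
    (mem_inter.mpr ⟨by simpa using htj, hj⟩)
  · simp [heq]
  · rw [card_pair h, hthree]

theorem three_le_card_union_inter (hP : IsUnitaryPattern K P)
    (hmeet : ∀ a b, (rowSupport P a ∩ rowSupport P b).Nonempty) (h : i ≠ i') (h' : i ≠ i'')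
    (h'' : i' ≠ i'') :
    3 ≤ #(rowSupport P i ∩ rowSupport P i' ∪ rowSupport P i ∩ rowSupport P i'' ∪
      rowSupport P i' ∩ rowSupport P i'') := by
  have hle : #{i, i', i''} ≤ #(rowSupport P i ∩ rowSupport P i' ∪
      rowSupport P i ∩ rowSupport P i'' ∪ rowSupport P i' ∩ rowSupport P i'') := by
    refine hP.card_le ?_ ?_
    · have := hmeet i i'
      have := hmeet i' i''
      simp only [Finset.Nonempty, mem_inter, mem_union, mem_insert, mem_singleton] at *
      grind
    · intro a ha b hb hab j hj
      simp only [coe_insert, coe_singleton, Set.mem_insert_iff, Set.mem_singleton_iff, mem_inter,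
        mem_union] at *
      grind
  rwa [card_eq_three.mpr ⟨i, i', i'', h, h', h'', rfl⟩] at hle

end Obstructions

end IsUnitaryPattern

/-- Necessary conditions on some rows (listed by `P`) of a unitary pattern of size at most five in
which every row and every column has at least three ones. They pass to any set of rows, so they can
be tested on a partially built pattern; in the second one, `P` being part of a pattern with `n`
rows, column `j` can still collect three ones only if it has at most `n - 3` zeros. -/
def IsAdmissible {k n : ℕ} (P : Matrix (Fin k) (Fin n) Bool) : Prop :=
  (∀ i, 3 ≤ #(rowSupport P i)) ∧ (∀ j, #{i | j ∉ rowSupport P i} + 3 ≤ n) ∧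
  (∀ i i', i < i' → #(rowSupport P i ∩ rowSupport P i') ≠ 1) ∧
  (∀ i i', i < i' → rowSupport P i = rowSupport P i' → #(rowSupport P i) = 3 →
    ∀ s, rowSupport P i ⊆ rowSupport P s) ∧
  ∀ i i' i'', i < i' → i' < i'' →
    3 ≤ #(rowSupport P i ∩ rowSupport P i' ∪ rowSupport P i ∩ rowSupport P i'' ∪
      rowSupport P i' ∩ rowSupport P i'')

instance {k n : ℕ} (P : Matrix (Fin k) (Fin n) Bool) : Decidable (IsAdmissible P) := by
  unfold IsAdmissible
  infer_instance

theorem IsUnitaryPattern.isAdmissible {K : Type*} [Field K] [PartialOrder K] [StarRing K]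
    [StarOrderedRing K] {n : ℕ} (hn : n ≤ 5) {P : Matrix (Fin n) (Fin n) Bool}
    (hP : IsUnitaryPattern K P) (hrow : ∀ i, 3 ≤ #(rowSupport P i))
    (hcol : ∀ j, 3 ≤ #(rowSupport Pᵀ j)) : IsAdmissible P := by
  have hmeet (i i' : Fin n) : (rowSupport P i ∩ rowSupport P i').Nonempty := by
    refine inter_nonempty_of_card_lt_card_add_card (subset_univ _) (subset_univ _) ?_
    have := hrow i
    have := hrow i'
    rw [card_univ, Fintype.card_fin]
    lia
  refine ⟨hrow, fun j => ?_, fun i i' h => hP.card_rowSupport_inter_ne_one h.ne,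
    fun i i' h heq hthree s =>
      hP.rowSupport_subset_of_rowSupport_eq h.ne heq hthree hcol (hmeet s i),
    fun i i' i'' h h' => hP.three_le_card_union_inter hmeet h.ne (h.trans h').ne h'.ne⟩
  have hcompl : ({i | j ∉ rowSupport P i} : Finset (Fin n)) = (rowSupport Pᵀ j)ᶜ := by
    ext i
    simp
  have hsplit := card_add_card_compl (rowSupport Pᵀ j)
  rw [Fintype.card_fin, ← hcompl] at hsplit
  have := hcol j
  lia

/-! ### Sorted patterns -/

theorem monotone_of_forall_sum_mul_comp_perm_le {k : ℕ} {w f : Fin k → ℕ}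
    (hw : StrictMono w)
    (hmax : ∀ σ : Equiv.Perm (Fin k), ∑ i, w i * f (σ i) ≤ ∑ i, w i * f i) : Monotone f := by
  have hsort : Monovary w (f ∘ Tuple.sort f) := hw.monotone.monovary (Tuple.monotone_sort f)
  have hvary : Monovary w f := by
    by_contra h
    refine (hmax (Tuple.sort f)).not_gt ?_
    simpa [Function.comp_def] using
      (hsort.sum_mul_comp_perm_lt_sum_mul_iff (σ := (Tuple.sort f)⁻¹)).mpr
        (by simpa [Function.comp_def] using h)
  intro i j hij
  by_contra! hlt
  exact (hw.le_iff_le.mp (hvary hlt)).not_gt (lt_of_le_of_ne hij (by rintro rfl; exact hlt.false))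

theorem ofBits_eq_sum {n : ℕ} (f : Fin n → Bool) :
    Nat.ofBits f = ∑ j : Fin n, 2 ^ (j : ℕ) * (f j).toNat := by
  induction n with
  | zero => rfl
  | succ n ih =>
    simp only [Nat.ofBits_succ, ih, Fin.sum_univ_succ, mul_sum, Function.comp_apply, Fin.val_zero,
      Fin.val_succ, pow_zero, one_mul, pow_succ']
    simp only [mul_assoc, add_comm]

section Sorting

variable {k n : ℕ}

/-- The rows of `P`, read as binary numerals with the least significant bit first, increase from
top to bottom, and likewise its columns from left to right. -/
def IsSorted (P : Matrix (Fin k) (Fin n) Bool) : Prop :=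
  (Monotone fun i => Nat.ofBits (P i)) ∧ Monotone fun j => Nat.ofBits (Pᵀ j)

theorem isChain_ofFn_iff_monotone (f : Fin n → ℕ) :
    (List.ofFn f).IsChain (· ≤ ·) ↔ Monotone f := by
  rw [List.isChain_iff_pairwise, List.pairwise_ofFn, monotone_iff_forall_lt]

instance (P : Matrix (Fin k) (Fin n) Bool) : Decidable (IsSorted P) :=
  decidable_of_iff ((List.ofFn fun i => Nat.ofBits (P i)).IsChain (· ≤ ·) ∧
    (List.ofFn fun j => Nat.ofBits (Pᵀ j)).IsChain (· ≤ ·)) <|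
    and_congr (isChain_ofFn_iff_monotone _) (isChain_ofFn_iff_monotone _)

/-- The sum of `2 ^ (i + j)` over the nonzero positions `(i, j)` of `P`. A rearrangement of the
rows and columns of `P` that maximizes this sum is sorted. -/
def weight (P : Matrix (Fin k) (Fin n) Bool) : ℕ :=
  ∑ i : Fin k, 2 ^ (i : ℕ) * Nat.ofBits (P i)

theorem weight_transpose (P : Matrix (Fin k) (Fin n) Bool) : weight Pᵀ = weight P := by
  simp only [weight, ofBits_eq_sum, mul_sum, transpose_apply]
  rw [sum_comm]
  exact sum_congr rfl fun i _ => sum_congr rfl fun j _ => mul_left_comm _ _ _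

theorem isSorted_of_weight_submatrix_le {P : Matrix (Fin k) (Fin n) Bool}
    (hmax : ∀ (σ : Equiv.Perm (Fin k)) (τ : Equiv.Perm (Fin n)),
      weight (P.submatrix σ τ) ≤ weight P) : IsSorted P := by
  have hpow (l : ℕ) : StrictMono fun i : Fin l => 2 ^ (i : ℕ) :=
    (pow_right_strictMono₀ one_lt_two).comp Fin.val_strictMono
  refine ⟨monotone_of_forall_sum_mul_comp_perm_le (hpow k) fun σ => hmax σ 1,
    monotone_of_forall_sum_mul_comp_perm_le (hpow n) fun τ => ?_⟩
  have h := hmax 1 τ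
  rw [← weight_transpose, ← weight_transpose P] at h
  exact h

theorem exists_weight_submatrix_le (P : Matrix (Fin k) (Fin n) Bool) :
    ∃ (σ : Equiv.Perm (Fin k)) (τ : Equiv.Perm (Fin n)),
      ∀ (σ' : Equiv.Perm (Fin k)) (τ' : Equiv.Perm (Fin n)),
        weight ((P.submatrix σ τ).submatrix σ' τ') ≤ weight (P.submatrix σ τ) := by
  obtain ⟨⟨σ, τ⟩, hmax⟩ := Finite.exists_max fun p : Equiv.Perm (Fin k) × Equiv.Perm (Fin n) =>
    weight (P.submatrix p.1 p.2)
  exact ⟨σ, τ, fun σ' τ' => hmax (σ * σ', τ * τ')⟩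

theorem IsSorted.submatrix_succ {P : Matrix (Fin (k + 1)) (Fin n) Bool} (hP : IsSorted P) :
    IsSorted (P.submatrix Fin.succ id) := by
  refine ⟨hP.1.comp Fin.strictMono_succ.monotone, fun j j' hjj' => ?_⟩
  have h : Nat.ofBits (Pᵀ j) ≤ Nat.ofBits (Pᵀ j') := hP.2 hjj'
  rw [Nat.ofBits_succ, Nat.ofBits_succ] at h
  change Nat.ofBits (Pᵀ j ∘ Fin.succ) ≤ Nat.ofBits (Pᵀ j' ∘ Fin.succ)
  have := (Pᵀ j 0).toNat_le
  have := (Pᵀ j' 0).toNat_le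
  lia

end Sorting

/-! ### Enumeration of the admissible patterns -/

section Enumeration

variable {k n : ℕ}

theorem IsAdmissible.submatrix_succ {P : Matrix (Fin (k + 1)) (Fin n) Bool} (hP : IsAdmissible P) :
    IsAdmissible (P.submatrix Fin.succ id) := by
  obtain ⟨hrow, hcol, hpair, heq, htriple⟩ := hP
  refine ⟨fun i => hrow i.succ, fun j => ?_, fun i i' h => hpair _ _ (Fin.succ_lt_succ_iff.mpr h),
    fun i i' h h' h'' s => heq _ _ (Fin.succ_lt_succ_iff.mpr h) h' h'' s.succ,
    fun i i' i'' h h' => htriple _ _ _ (Fin.succ_lt_succ_iff.mpr h) (Fin.succ_lt_succ_iff.mpr h')⟩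
  refine (Nat.add_le_add_right (card_le_card_of_injOn Fin.succ (fun i hi => ?_)
    (Fin.succ_injective k).injOn) 3).trans (hcol j)
  simpa using hi

/-- The matrix with first row `r` and remaining rows `P`. It is `Matrix.vecCons`, defined by
matching on the value of the index because the kernel evaluates this much faster. -/
def consRow (r : Fin n → Bool) (P : Matrix (Fin k) (Fin n) Bool) :
    Matrix (Fin (k + 1)) (Fin n) Bool
  | ⟨0, _⟩ => r
  | ⟨i + 1, h⟩ => P ⟨i, Nat.lt_of_succ_lt_succ h⟩

theorem consRow_submatrix_succ (P : Matrix (Fin (k + 1)) (Fin n) Bool) :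
    consRow (P 0) (P.submatrix Fin.succ id) = P := by
  ext ⟨_ | i, h⟩ j <;> rfl

/-- The rows of length `n` with at least three ones. -/
def rowCandidates (n : ℕ) : List (Fin n → Bool) :=
  ((List.range (2 ^ n)).map fun c (j : Fin n) => c.testBit j).filter fun r => 3 ≤ #{j | r j}

theorem mem_rowCandidates {r : Fin n → Bool} (hr : 3 ≤ #{j | r j}) : r ∈ rowCandidates n := by
  refine List.mem_filter.mpr ⟨List.mem_map.mpr ⟨Nat.ofBits r, ?_, ?_⟩, by simpa using hr⟩
  · exact List.mem_range.mpr (Nat.ofBits_lt_two_pow r)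
  · funext j
    exact Nat.testBit_ofBits_lt r j j.2

/-- The sorted admissible patterns with `k` rows, built by adding rows at the top. -/
def admissiblePatterns (n : ℕ) : (k : ℕ) → List (Matrix (Fin k) (Fin n) Bool)
  | 0 => [fun _ _ => true]
  | k + 1 => (admissiblePatterns n k).flatMap fun P =>
      ((rowCandidates n).map fun r => consRow r P).filter fun P => IsSorted P ∧ IsAdmissible P

theorem mem_admissiblePatterns {P : Matrix (Fin k) (Fin n) Bool} (hsort : IsSorted P)
    (hadm : IsAdmissible P) : P ∈ admissiblePatterns n k := by
  induction k with
  | zero => exact List.mem_singleton.mpr (Subsingleton.elim _ _)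
  | succ k ih =>
    have htail := ih hsort.submatrix_succ hadm.submatrix_succ
    refine List.mem_flatMap.mpr ⟨_, htail, List.mem_filter.mpr ⟨List.mem_map.mpr
      ⟨P 0, mem_rowCandidates (hadm.1 0), consRow_submatrix_succ P⟩, ?_⟩⟩
    exact decide_eq_true ⟨hsort, hadm⟩

end Enumeration

/-! ### Realization by integer matrices -/

section Realization

/-- The positions of the nonzero entries of an integer matrix. -/
def nonzeroPattern {ι κ : Type*} (M : Matrix ι κ ℤ) : Matrix ι κ Bool :=
  M.map (· != 0)

theorem isUnitaryPattern_nonzeroPattern {ι : Type*} [Fintype ι] [DecidableEq ι] {d : ℤ}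
    {M : Matrix ι ι ℤ} (hd : d ≠ 0) (hM : M * Mᵀ = d ^ 2 • (1 : Matrix ι ι ℤ)) :
    IsUnitaryPattern ℚ (nonzeroPattern M) := by
  have hd' : (d : ℚ) ≠ 0 := Int.cast_ne_zero.mpr hd
  have hcast : M.map (Int.castRingHom ℚ) * (M.map (Int.castRingHom ℚ))ᵀ =
      (d : ℚ) ^ 2 • (1 : Matrix ι ι ℚ) := by
    rw [← Matrix.transpose_map, ← Matrix.map_mul, hM]
    ext i j
    simp only [map_apply, Matrix.smul_apply, Matrix.one_apply, smul_eq_mul]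
    split_ifs <;> simp
  refine ⟨(d : ℚ)⁻¹ • M.map (Int.castRingHom ℚ), ?_, fun i j => ?_⟩
  · rw [mem_unitaryGroup_iff, star_eq_conjTranspose, conjTranspose_eq_transpose_of_trivial,
      transpose_smul, smul_mul_smul_comm, hcast, smul_smul, ← mul_inv, ← sq,
      inv_mul_cancel₀ (pow_ne_zero 2 hd'), one_smul]
  · simp [nonzeroPattern, hd']

/-- Pairs `(d, M)` such that `d⁻¹ • M` is orthogonal. For `n ∈ {3, 4, 5}` their patterns are, up to
transposition and permutations of the rows and of the columns, all unitary patterns of size `n`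
with at least three ones in every row and every column. -/
def orthogonalTable : (n : ℕ) → List (ℤ × Matrix (Fin n) (Fin n) ℤ)
  | 3 => [(3, !![1, -2, 2; -2, 1, 2; 2, 2, 1])]
  | 4 =>
    [(2, !![-1, -1, 1, 1; -1, 1, -1, 1; 1, -1, -1, 1; 1, 1, 1, 1]),
     (9, !![0, -3, -6, 6; -3, 8, -2, 2; -6, -2, 5, 4; 6, 2, 4, 5]),
     (9, !![1, 0, -4, 8; 0, -6, 6, 3; -8, 3, 2, 2; 4, 6, 5, 2]),
     (33, !![-32, 1, 0, 8; 7, 0, -16, 28; 0, -32, 7, 4; 4, 8, 28, 15]),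
     (3, !![2, 2, -1, 0; 2, -2, 0, 1; -1, 0, -2, 2; 0, 1, 2, 2])]
  | 5 =>
    [(5, !![2, 2, -3, -2, 2; -3, 2, 2, -2, 2; -2, -2, -2, 2, 3; 2, -3, 2, -2, 2; 2, 2, 2, 3, 2]),
     (4, !![0, -2, 2, 2, 2; 2, -1, 1, -3, 1; 2, -1, -3, 1, 1; -2, 1, -1, -1, 3; 2, 3, 1, 1, 1]),
     (7, !![-1, 0, -4, 4, 4; 0, -5, 4, 2, 2; 4, -2, -2, -4, 3; -4, 2, 2, -3, 4; 4, 4, 3, 2, 2]),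
     (11, !![0, -1, -10, 4, 2; 0, 2, -2, -8, 7; 6, -8, 2, 1, 4; -9, -4, 2, 2, 4; 2, 6, 3, 6, 6]),
     (9, !![0, 0, -6, 3, 6; 0, -8, 2, -2, 3; -6, 3, 2, -4, 4; 6, 2, -1, -6, 2; 3, 2, 6, 4, 4]),
     (11, !![4, -5, 0, -4, 8; -10, 0, 1, -2, 4; 0, 4, -10, -1, 2; 2, 8, 4, -6, 1; 1, 4, 2, 8, 6]),
     (13, !![4, 0, -9, -6, 6; 0, -10, 2, 4, 7; 0, -1, 8, -10, 2; -12, 2, -2, -1, 4; 3, 8, 4, 4, 8]),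
     (5, !![-1, 2, -4, 0, 2; 2, -1, 0, -4, 2; -4, 0, 2, -1, 2; 0, -4, -1, 2, 2; 2, 2, 2, 2, 3]),
     (6, !![2, 0, 0, -4, 4; 0, 5, -3, 1, 1; 0, -3, -3, 3, 3; -4, 1, 3, 1, 3; 4, 1, 3, 3, 1]),
     (9, !![0, 0, -3, -6, 6; 0, 0, -6, 6, 3; -3, -6, 4, 2, 4; -6, 6, 2, 1, 2; 6, 3, 4, 2, 4]),
     (9, !![0, -6, 0, 6, 3; -6, 0, 5, -2, 4; 0, 5, -4, 2, 6; 3, -4, -2, -6, 4; 6, 2, 6, 1, 2]),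
     (15, !![-10, 4, 0, 10, 3; -5, 0, 6, -8, 10; 0, -12, -6, 3, 6; 0, 7, -12, -4, 4;
       10, 4, 3, 6, 8]),
     (21, !![0, 0, 6, -9, 18; -14, 0, -9, 10, 8; 0, -14, 12, 10, 1; 14, -7, -12, 4, 6;
       7, 14, 6, 12, 4]),
     (9, !![-6, 0, 0, -3, 6; 0, 0, -6, 6, 3; 0, -6, 5, 4, 2; 6, -3, -2, -4, 4; 3, 6, 4, 2, 4]),
     (21, !![7, -18, 0, 8, 2; 0, 0, -13, -4, 16; -14, 0, 8, 10, 9; 0, -6, 12, -15, 6;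
       14, 9, 8, 6, 8]),
     (21, !![-18, 6, 0, 0, 9; 6, 0, -6, -15, 12; 0, -15, 10, 4, 10; 0, -6, -17, 10, 4;
       9, 12, 4, 10, 10]),
     (27, !![0, -3, -24, 0, 12; -25, 8, 0, 6, 2; -2, 0, 10, -15, 20; 0, -16, 7, 18, 10;
       10, 20, 2, 12, 9]),
     (33, !![22, -20, 13, 0, 6; -22, -20, 0, 3, 14; 11, 0, -26, 6, 16; 0, 15, 12, -12, 24;
       0, 8, 10, 30, 5]),
     (105, !![60, -80, 20, 25, 0; 42, 19, -50, 0, 80; -69, -58, 0, -20, 50; 30, 0, 30, -96, 3;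
       0, 30, 85, 28, 46]),
     (9, !![1, 0, -8, 0, 4; -8, 3, 0, 2, 2; 0, 0, 3, -6, 6; 0, -6, 2, 5, 4; 4, 6, 2, 4, 3]),
     (15, !![10, 10, -5, 0, 0; 10, -10, 0, 4, 3; -5, 0, -10, 8, 6; 0, -3, -6, -12, 6;
       0, 4, 8, 1, 12]),
     (21, !![14, 9, -10, 0, 8; 7, -18, 0, 2, 8; 0, 0, 4, -20, 5; -14, 0, -10, 1, 12;
       0, 6, 15, 6, 12]),
     (21, !![0, -4, -5, 20, 0; -6, 15, -12, 0, 6; -9, -10, 0, -2, 16; 18, 0, -4, -1, 10;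
       0, 10, 16, 6, 7]),
     (273, !![52, -65, 0, 260, 0; 65, 52, -208, 0, 156; 0, -252, 0, -63, 84;
       -260, 0, -52, 52, 39; 0, 64, 169, 16, 204])]
  | _ => []

theorem orthogonalTable_isOrthogonal {n : ℕ} :
    ∀ M ∈ orthogonalTable n, M.1 ≠ 0 ∧ M.2 * M.2ᵀ = M.1 ^ 2 • (1 : Matrix (Fin n) (Fin n) ℤ) := by
  match n with
  | 3 | 4 | 5 => decide +kernel
  | 0 | 1 | 2 | _ + 6 => simp [orthogonalTable]

theorem isUnitaryPattern_of_mem_orthogonalTable {n : ℕ} {M : ℤ × Matrix (Fin n) (Fin n) ℤ}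
    (hM : M ∈ orthogonalTable n) : IsUnitaryPattern ℚ (nonzeroPattern M.2) :=
  have ⟨hd, horth⟩ := orthogonalTable_isOrthogonal M hM
  isUnitaryPattern_nonzeroPattern hd horth

end Realization

section Exhaustion

variable {m : ℕ}

/-- A reason for which `P` can be discarded from the search: two of its columns are nonzero
simultaneously in exactly one row, or exchanging two neighbouring rows and two neighbouring columns
(the last neighbours the first) increases its weight, or `P` is listed in the table up to
transposition. -/
def IsSettled (P : Matrix (Fin (m + 1)) (Fin (m + 1)) Bool) : Prop :=
  (∃ j j', j < j' ∧ #(rowSupport Pᵀ j ∩ rowSupport Pᵀ j') = 1) ∨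
  (∃ i j, weight P < weight (P.submatrix (Equiv.swap i (i + 1)) (Equiv.swap j (j + 1)))) ∨
  ∃ M ∈ orthogonalTable (m + 1), P = nonzeroPattern M.2 ∨ P = nonzeroPattern M.2ᵀ

instance (P : Matrix (Fin (m + 1)) (Fin (m + 1)) Bool) : Decidable (IsSettled P) := by
  unfold IsSettled
  infer_instance

set_option maxHeartbeats 2000000 in
-- The kernel carries out the enumeration for sizes three, four and five.
theorem isSettled_of_mem_admissiblePatterns (h2 : 2 ≤ m) (h4 : m ≤ 4)
    {P : Matrix (Fin (m + 1)) (Fin (m + 1)) Bool} (hP : P ∈ admissiblePatterns (m + 1) (m + 1)) :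
    IsSettled P := by
  have hall : (admissiblePatterns (m + 1) (m + 1)).all (IsSettled ·) = true := by
    interval_cases m <;> decide +kernel
  exact of_decide_eq_true (List.all_eq_true.mp hall P hP)

end Exhaustion

/-! ### Rational realization of unitary patterns -/

namespace IsUnitaryPattern

variable {K : Type*} [Field K] [PartialOrder K] [StarRing K] [StarOrderedRing K]

theorem rat_of_isSettled {m : ℕ} {P : Matrix (Fin (m + 1)) (Fin (m + 1)) Bool}
    (hP : IsUnitaryPattern K P) (hsettled : IsSettled P)
    (hmax : ∀ σ τ : Equiv.Perm (Fin (m + 1)), weight (P.submatrix σ τ) ≤ weight P) :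
    IsUnitaryPattern ℚ P := by
  obtain ⟨j, j', hjj', hone⟩ | ⟨i, j, hlt⟩ | ⟨M, hM, rfl | rfl⟩ := hsettled
  · exact absurd hone (hP.transpose.card_rowSupport_inter_ne_one hjj'.ne)
  · exact absurd hlt (hmax _ _).not_gt
  · exact isUnitaryPattern_of_mem_orthogonalTable hM
  · exact (isUnitaryPattern_of_mem_orthogonalTable hM).transpose

theorem rat_of_three_le_card {m : ℕ} (h2 : 2 ≤ m) (h4 : m ≤ 4)
    {P : Matrix (Fin (m + 1)) (Fin (m + 1)) Bool} (hP : IsUnitaryPattern K P)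
    (hrow : ∀ i, 3 ≤ #(rowSupport P i)) (hcol : ∀ j, 3 ≤ #(rowSupport Pᵀ j)) :
    IsUnitaryPattern ℚ P := by
  obtain ⟨σ, τ, hmax⟩ := exists_weight_submatrix_le P
  have hQ : IsUnitaryPattern K (P.submatrix σ τ) := hP.submatrix σ τ
  have hadm : IsAdmissible (P.submatrix σ τ) := by
    refine hQ.isAdmissible (by lia) (fun i => ?_) fun j => ?_
    · rw [card_rowSupport_submatrix]
      exact hrow _
    · rw [transpose_submatrix, card_rowSupport_submatrix]
      exact hcol _
  have hmem := mem_admissiblePatterns (isSorted_of_weight_submatrix_le hmax) hadm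
  exact of_submatrix (hQ.rat_of_isSettled (isSettled_of_mem_admissiblePatterns h2 h4 hmem) hmax)

theorem rat {n : ℕ} (hn : n ≤ 5) {P : Matrix (Fin n) (Fin n) Bool} (hP : IsUnitaryPattern K P) :
    IsUnitaryPattern ℚ P := by
  induction n with
  | zero => exact hP.rat_of_subsingleton
  | succ m ih =>
    obtain _ | m := m
    · exact rat_of_subsingleton (ι := Fin 1) hP
    have ih' (Q : Matrix (Fin (m + 1)) (Fin (m + 1)) Bool) (hQ : IsUnitaryPattern K Q) :
        IsUnitaryPattern ℚ Q := ih (by lia) hQ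
    by_cases hrow : ∃ i, #(rowSupport P i) ≤ 2
    · obtain ⟨i, hi⟩ := hrow
      exact hP.rat_of_card_rowSupport_le_two ih' hi
    by_cases hcol : ∃ j, #(rowSupport Pᵀ j) ≤ 2
    · obtain ⟨j, hj⟩ := hcol
      exact (hP.transpose.rat_of_card_rowSupport_le_two ih' hj).of_transpose
    push Not at hrow hcol
    have hthree : 3 ≤ m + 2 := (hrow 0).trans_le (card_finset_fin_le _)
    exact hP.rat_of_three_le_card (by lia) (by lia) hrow hcol

end IsUnitaryPattern

theorem zeroPattern_eq_iff {m n K L : Type*} [Field K] [Field L] {X : Matrix m n K}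
    {Y : Matrix m n L} : zeroPattern X = zeroPattern Y ↔ ∀ i j, X i j ≠ 0 ↔ Y i j ≠ 0 := by
  classical
  rw [← Matrix.ext_iff]
  refine forall_congr' fun i => forall_congr' fun j => ?_
  by_cases hX : X i j = 0 <;> by_cases hY : Y i j = 0 <;> simp [zeroPattern, hX, hY]

theorem ratCast_mem_rationalOrthogonal {n : ℕ} {Z : Matrix (Fin n) (Fin n) ℚ}
    (hZ : Z ∈ unitaryGroup (Fin n) ℚ) : Z.map (Rat.castHom ℝ) ∈ rationalOrthogonal n := by
  refine ⟨?_, fun i j => ⟨Z i j, rfl⟩⟩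
  rw [mem_unitaryGroup_iff, star_eq_conjTranspose, conjTranspose_eq_transpose_of_trivial] at hZ
  rw [mem_orthogonalGroup_iff, ← transpose_map, ← Matrix.map_mul, hZ,
    Matrix.map_one _ (map_zero _) (map_one _)]

theorem mainTheorem1_general {K : Type*} [Field K] [PartialOrder K] [StarRing K]
    [StarOrderedRing K] {n : ℕ} (hn : n ≤ 5) {X : Matrix (Fin n) (Fin n) K}
    (hX : X ∈ unitaryGroup (Fin n) K) :
    ∃ Z ∈ rationalOrthogonal n, zeroPattern X = zeroPattern Z := by
  classical
  have hpattern : IsUnitaryPattern K (of fun i j => decide (X i j ≠ 0)) :=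
    ⟨X, hX, fun i j => by simp⟩
  obtain ⟨Z, hZ, hXZ⟩ := hpattern.rat hn
  refine ⟨Z.map (Rat.castHom ℝ), ratCast_mem_rationalOrthogonal hZ,
    zeroPattern_eq_iff.mpr fun i j => ?_⟩
  simpa using hXZ i j

open ComplexOrder in
theorem mainTheorem1 (n : ℕ) (hn : n ≤ 5) :
    (∀ X ∈ Matrix.unitaryGroup (Fin n) ℂ, ∃ Y ∈ Matrix.orthogonalGroup (Fin n) ℝ,
      zeroPattern X = zeroPattern Y) ∧
    (∀ Y ∈ Matrix.orthogonalGroup (Fin n) ℝ, ∃ Z ∈ rationalOrthogonal n,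
      zeroPattern Y = zeroPattern Z) :=
  ⟨fun _ hX => have ⟨Y, hY, hXY⟩ := mainTheorem1_general hn hX; ⟨Y, hY.1, hXY⟩,
    fun _ hY => mainTheorem1_general hn hY⟩
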